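/- A partition is a finite multiset of positive integers (its parts). A three-colored partition $\lambda$ of $n$ is a finite multiset of positive integers, each carrying one of the colors black, red, green, with sum $n$; let $\lambda_b,\lambda_r,\lambda_g$ be the subpartitions of its black, red and green parts, and $\ell_b,\ell_r,\ell_g$ their numbers of parts. If $\lambda_b\neq\emptyset$, let $k$ be the smallest black part, and if moreover $\ell_r\ge k$, let $i_k$ be the $k$-th smallest red part (counted with multiplicity). For an integer $r\ge 2$ let $\mathcal B_{r,r}(n)$ be the set of partitions $\lambda_1\ge\dots\ge\lambda_s$ of $n$ with $\lambda_j-\lambda_{j+r-1}\ge 2$ for all $1\le j\le s-r+1$ and with at most $r-1$ parts equal to $1$, and let $B_{r,r}(n)$ be its cardinality. A three-colored partition is of type $3.b$ (with respect to $r$) if its parts have exactly two colors, black and red, and $\ell_r\ge k$ and $k+i_k\ge r$. It is of type $4.b$ (with respect to $r$) if its parts have exactly three colors, $\lambda_g\in\mathcal B_{r,r}(m)$ for some integer $m$, and $\ell_r\ge k$, $k+i_k\ge r$ and $\ell_g-\#\{1_g\}<k+i_k-r+1$, where $\#\{1_g\}$ is the number of green parts equal to $1$. Let $\mathbf H=\sum_{n\ge0}p(n)q^n$,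 where $p(n)$ is the number of partitions of $n$, let $\mathbf G_r=\sum_{n\ge0}B_{r,r}(n)q^n$, and let $S_{3,b}$ and $S_{4,b}$ be the generating series $\sum_{n\ge0}(\cdot)\,q^n$ of the numbers of three-colored partitions of $n$ of type $3.b$ and of type $4.b$, respectively. Proposition 4.3. For every integer $r\ge 2$, as formal power series in $q$, $$S_{4,b}=\frac{\mathbf H^2-\mathbf H\,\mathbf G_r}{1-q}-S_{3,b}.$$ -/

import Mathlib

namespace ThreeColored

/-- The three colors. -/
inductive Color : Type
  | black
  | red
  | green
  deriving DecidableEq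

instance instFintypeColor : Fintype Color :=
  ⟨{.black, .red, .green}, fun c => by cases c <;> decide⟩

/-- A three-colored partition of `n`: a finite multiset of colored parts, i.e. of pairs
`(color, size)` with positive size, whose sizes sum to `n`. -/
@[ext]
structure ColoredPartition (n : ℕ) where
  parts : Multiset (Color × ℕ)
  parts_pos : ∀ a ∈ parts, 0 < a.2
  parts_sum : (parts.map Prod.snd).sum = n

/-- There are finitely many three-colored partitions of `n`, so that counting them with `Nat.card`
or `Set.ncard` is meaningful. -/
instance instFiniteColoredPartition (n : ℕ) : Finite (ColoredPartition n) := by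
  have key : ∀ p : ColoredPartition n, p.parts ≤
      n • ((Finset.univ : Finset Color) ×ˢ Finset.Icc 1 n).val := by
    intro p
    have hcard : p.parts.card ≤ n := by
      have h := Multiset.card_nsmul_le_sum (s := p.parts.map Prod.snd) (a := 1) (by
        intro x hx
        obtain ⟨a, ha, rfl⟩ := Multiset.mem_map.1 hx
        exact p.parts_pos a ha)
      simpa [p.parts_sum] using h
    rw [Multiset.le_iff_count]
    intro a
    by_cases ha : a ∈ p.parts
    · have h2 : a.2 ≤ n := by
        have := Multiset.le_sum_of_mem (Multiset.mem_map_of_mem Prod.snd ha)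
        rwa [p.parts_sum] at this
      have hmem : a ∈ ((Finset.univ : Finset Color) ×ˢ Finset.Icc 1 n) := by
        simp only [Finset.mem_product, Finset.mem_univ, Finset.mem_Icc, true_and]
        exact ⟨p.parts_pos a ha, h2⟩
      rw [Multiset.count_nsmul,
        Multiset.count_eq_one_of_mem (Finset.nodup _) hmem, mul_one]
      exact (Multiset.count_le_card _ _).trans hcard
    · rw [Multiset.count_eq_zero_of_notMem ha]
      exact Nat.zero_le _
  refine Finite.of_injective
    (β := {s // s ∈ (n • ((Finset.univ : Finset Color) ×ˢ Finset.Icc 1 n).val).powerset.toFinset})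
    (fun p => ⟨p.parts, by simpa using key p⟩) ?_
  intro p p' h
  exact ColoredPartition.ext (congrArg Subtype.val h)

/-- The subpartition `λ_c` formed by the parts of color `c`, as a multiset of positive integers. -/
def ColoredPartition.sub {n : ℕ} (p : ColoredPartition n) (c : Color) : Multiset ℕ :=
  (p.parts.filter fun a => a.1 = c).map Prod.snd

/-- The `k`-th smallest element of `s`, counted with multiplicity and starting with `k = 1`.
It is only used for `1 ≤ k ≤ card s` (the value is `0` when `card s < k`). -/
def kthSmallest (s : Multiset ℕ) (k : ℕ) : ℕ :=
  (s.sort (· ≤ ·)).getD (k - 1) 0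

/-- The smallest element of `s`. It is only used for `s ≠ 0`. -/
def smallest (s : Multiset ℕ) : ℕ := kthSmallest s 1

/-- Gordon's conditions for the partition with multiset of parts `s`: writing the parts in
non-increasing order, `λ_j - λ_{j+r-1} ≥ 2` whenever both parts exist, and at most `i - 1` parts
are equal to `1`. -/
def IsGordon (r i : ℕ) (s : Multiset ℕ) : Prop :=
  (∀ (j : ℕ) (h : j + (r - 1) < (s.sort (· ≥ ·)).length),
      (s.sort (· ≥ ·))[j + (r - 1)] + 2 ≤ (s.sort (· ≥ ·))[j]) ∧
    s.count 1 ≤ i - 1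

/-- The set `𝓑_{r,i}(n)` of Gordon's identities. -/
def gordonSet (r i n : ℕ) : Set n.Partition := {p | IsGordon r i p.parts}

/-- Type `3.b`: exactly two colors, black and red, and, with `k` the smallest black part,
there are at least `k` red parts and the `k`-th smallest red part `i_k` satisfies `k + i_k ≥ r`. -/
def IsType3b (r : ℕ) {n : ℕ} (p : ColoredPartition n) : Prop :=
  p.sub .black ≠ 0 ∧ p.sub .red ≠ 0 ∧ p.sub .green = 0 ∧
    smallest (p.sub .black) ≤ (p.sub .red).card ∧
    r ≤ smallest (p.sub .black) + kthSmallest (p.sub .red) (smallest (p.sub .black))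

/-- Type `4.b`: exactly three colors, the green subpartition satisfies Gordon's conditions
defining `𝓑_{r,r}`, and, with `k` the smallest black part, there are at least `k` red parts, the
`k`-th smallest red part `i_k` satisfies `k + i_k ≥ r`, and
`ℓ_g - #{1_g} < k + i_k - r + 1` (an inequality of integers). -/
def IsType4b (r : ℕ) {n : ℕ} (p : ColoredPartition n) : Prop :=
  p.sub .black ≠ 0 ∧ p.sub .red ≠ 0 ∧ p.sub .green ≠ 0 ∧
    IsGordon r r (p.sub .green) ∧
    smallest (p.sub .black) ≤ (p.sub .red).card ∧
    r ≤ smallest (p.sub .black) + kthSmallest (p.sub .red) (smallest (p.sub .black)) ∧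
    ((p.sub .green).card : ℤ) - ((p.sub .green).count 1 : ℤ) <
      (smallest (p.sub .black) : ℤ) +
        (kthSmallest (p.sub .red) (smallest (p.sub .black)) : ℤ) - (r : ℤ) + 1

open PowerSeries in
/-- `𝐇 = ∑ p(n) qⁿ`, the generating series of all partitions. -/
noncomputable def seriesH : ℚ⟦X⟧ :=
  PowerSeries.mk fun n => (Fintype.card n.Partition : ℚ)

open PowerSeries in
/-- `𝐆_r = ∑ B_{r,r}(n) qⁿ`. -/
noncomputable def seriesG (r : ℕ) : ℚ⟦X⟧ :=
  PowerSeries.mk fun n => ((gordonSet r r n).ncard : ℚ)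

open PowerSeries in
/-- The generating series of the three-colored partitions of type `3.b`. -/
noncomputable def seriesS3b (r : ℕ) : ℚ⟦X⟧ :=
  PowerSeries.mk fun n => ({p : ColoredPartition n | IsType3b r p}.ncard : ℚ)

open PowerSeries in
/-- The generating series of the three-colored partitions of type `4.b`. -/
noncomputable def seriesS4b (r : ℕ) : ℚ⟦X⟧ :=
  PowerSeries.mk fun n => ({p : ColoredPartition n | IsType4b r p}.ncard : ℚ)

end ThreeColored

namespace ThreeColored

/-! Write `k` for the smallest black part, `i` for the `k`-th smallest red part, and call `k + i`
the level. Since `ℓ_g - #{1_g}` counts the green parts other than `1` (`restCard`), types 3.b and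
4.b together are the triples with `restCard green + r ≤ level`, green being a Gordon partition.
Empty green is 3.b and nonempty green is 4.b. So the claim is `(1 - q) T = H (H - G)` for the series
`T` of these triples (`genSeries_coloredTriples`).

Black/red side. For fixed `k` and `i`, cutting red at its `k`-th smallest part leaves a box of `k -
1` parts at most `i`, counted by a Gaussian binomial (`seriesBox_mul`). The product with the black
series depends on `k` only through the level and a factor `q^(k-1)`. The geometric sum over `k`
gives `q^s H · seriesGE s / (1 - q)` at level `s` (`genSeries_blackRedPairs_level`).

Green side. Here `q^s · seriesGE s` counts nonempty partitions `P` with smallest part `s`. Hence `(1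
- q) T / H` counts pairs `(P, g)` with `P` nonempty, `g` Gordon and all parts of `P` at least
`restCard g + r`. Allowing `P` empty adds `G`, so it remains that all such separated pairs are
counted by `H` (`genSeries_separatedPairs`). If `P` has `j` parts, subtract `restCard g` from each
of them and add `j` to each part of `g` other than `1`. This preserves the total size and decouples
`P` from `g`. The resulting sum over `j` telescopes (`sum_seriesCard_mul_seriesGordon`), with limit
`H`.

Infinite sums are replaced throughout by congruences modulo every `X ^ N`. -/

open PowerSeries

/-! ### Generating series of weighted sets -/

/-- The generating series of the elements of `A`, counted according to the weight `w`. -/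
noncomputable def genSeries {α : Type*} (A : Set α) (w : α → ℕ) : ℚ⟦X⟧ :=
  PowerSeries.mk fun n => ({a | a ∈ A ∧ w a = n}.ncard : ℚ)

/-- Only finitely many elements of `A` have a given weight. -/
def FiniteFibers {α : Type*} (A : Set α) (w : α → ℕ) : Prop :=
  ∀ n, {a | a ∈ A ∧ w a = n}.Finite

section genSeries

variable {α β : Type*} {A B : Set α} {w : α → ℕ} {C : Set β} {v : β → ℕ}

theorem coeff_genSeries (A : Set α) (w : α → ℕ) (n : ℕ) :
    coeff n (genSeries A w) = ({a | a ∈ A ∧ w a = n}.ncard : ℚ) := by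
  simp [genSeries]

theorem FiniteFibers.mono (h : FiniteFibers B w) (hAB : A ⊆ B) : FiniteFibers A w :=
  fun n => (h n).subset fun _ ha => ⟨hAB ha.1, ha.2⟩

theorem FiniteFibers.le (h : FiniteFibers A w) (n : ℕ) : {a | a ∈ A ∧ w a ≤ n}.Finite := by
  refine ((Set.finite_Iic n).biUnion fun i _ => h i).subset ?_
  rintro a ⟨ha, hn⟩
  exact Set.mem_biUnion (Set.mem_Iic.2 hn) ⟨ha, rfl⟩

theorem FiniteFibers.prod (hA : FiniteFibers A w) (hC : FiniteFibers C v) :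
    FiniteFibers (A ×ˢ C) (fun p => w p.1 + v p.2) := by
  intro n
  refine ((hA.le n).prod (hC.le n)).subset ?_
  rintro ⟨a, c⟩ ⟨⟨ha, hc⟩, h⟩
  simp only at h ha hc
  exact ⟨⟨ha, by simp only; omega⟩, ⟨hc, by simp only; omega⟩⟩

/-- A weight-shifting bijection multiplies the generating series by a power of `X`. -/
theorem genSeries_of_inverse (f : α → β) (g : β → α) (c : ℕ)
    (hf : ∀ a ∈ A, f a ∈ C ∧ g (f a) = a ∧ v (f a) = w a + c)
    (hg : ∀ b ∈ C, g b ∈ A ∧ f (g b) = b) :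
    genSeries C v = X ^ c * genSeries A w := by
  ext n
  rw [coeff_X_pow_mul', coeff_genSeries]
  split_ifs with h
  · rw [coeff_genSeries]
    have : {a | a ∈ C ∧ v a = n} = f '' {a | a ∈ A ∧ w a = n - c} := by
      ext b
      constructor
      · rintro ⟨hb, hn⟩
        refine ⟨g b, ⟨(hg b hb).1, ?_⟩, (hg b hb).2⟩
        have := (hf _ (hg b hb).1).2.2
        rw [(hg b hb).2] at this
        omega
      · rintro ⟨a, ⟨ha, hn⟩, rfl⟩
        refine ⟨(hf a ha).1, ?_⟩
        have := (hf a ha).2.2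
        omega
    rw [this, Set.InjOn.ncard_image]
    intro a ha b hb hab
    rw [← (hf a ha.1).2.1, ← (hf b hb.1).2.1, hab]
  · have : {a | a ∈ C ∧ v a = n} = ∅ := by
      ext b
      simp only [Set.mem_ofPred_eq, Set.mem_empty_iff_false, iff_false, not_and]
      intro hb hn
      have := (hf _ (hg b hb).1).2.2
      rw [(hg b hb).2] at this
      omega
    simp [this]

/-- Finite fibers are essential: `ncard` is `0` on infinite sets and would not be additive. -/
theorem genSeries_split (hA : FiniteFibers A w) (p : α → Prop) :
    genSeries A w = genSeries {a | a ∈ A ∧ p a} w + genSeries {a | a ∈ A ∧ ¬ p a} w := by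
  ext n
  rw [map_add, coeff_genSeries, coeff_genSeries, coeff_genSeries, ← Nat.cast_add,
    ← Set.ncard_union_eq ?_ ((hA n).subset fun a ha => ⟨ha.1.1, ha.2⟩)
      ((hA n).subset fun a ha => ⟨ha.1.1, ha.2⟩)]
  · congr 2
    ext a
    simp only [Set.mem_ofPred_eq, Set.mem_union]
    tauto
  · rw [Set.disjoint_left]
    rintro a ⟨⟨_, h⟩, _⟩ ⟨⟨_, h'⟩, _⟩
    exact h' h

theorem genSeries_empty (w : α → ℕ) : genSeries (∅ : Set α) w = 0 := by
  ext n
  simp [coeff_genSeries]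

theorem genSeries_singleton (a : α) (w : α → ℕ) : genSeries {a} w = X ^ w a := by
  ext n
  rw [coeff_genSeries, coeff_X_pow]
  split_ifs with h
  · have : {b | b ∈ ({a} : Set α) ∧ w b = n} = {a} := by
      ext b
      simp only [Set.mem_singleton_iff, Set.mem_ofPred_eq, and_iff_left_iff_imp]
      rintro rfl
      exact h.symm
    rw [this, Set.ncard_singleton, Nat.cast_one]
  · have : {b | b ∈ ({a} : Set α) ∧ w b = n} = ∅ := by
      ext b
      simp only [Set.mem_singleton_iff, Set.mem_ofPred_eq, Set.mem_empty_iff_false, iff_false,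
        not_and]
      rintro rfl
      exact fun h' => h h'.symm
    rw [this, Set.ncard_empty, Nat.cast_zero]

theorem genSeries_lt (hA : FiniteFibers A w) (φ : α → ℕ) (N : ℕ) :
    genSeries {a | a ∈ A ∧ φ a < N} w =
      ∑ s ∈ Finset.range N, genSeries {a | a ∈ A ∧ φ a = s} w := by
  induction N with
  | zero =>
    rw [Finset.range_zero, Finset.sum_empty, ← genSeries_empty w]
    congr 1
    ext a
    simp
  | succ N ih =>
    rw [Finset.sum_range_succ, ← ih,
      genSeries_split (hA.mono fun a ha => ha.1) (fun a => φ a < N)]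
    congr 2 <;>
    · ext a
      simp only [Set.mem_ofPred_eq]
      constructor
      · rintro ⟨⟨h1, h2⟩, h3⟩
        exact ⟨h1, by omega⟩
      · rintro ⟨h1, h2⟩
        exact ⟨⟨h1, by omega⟩, by omega⟩

theorem X_pow_dvd_genSeries_sub (N : ℕ) (hAB : B ⊆ A) (h : ∀ a ∈ A, w a < N → a ∈ B) :
    (X : ℚ⟦X⟧) ^ N ∣ genSeries A w - genSeries B w := by
  rw [X_pow_dvd_iff]
  intro n hn
  rw [map_sub, coeff_genSeries, coeff_genSeries, sub_eq_zero]
  congr 2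
  ext a
  constructor
  · rintro ⟨h1, h2⟩
    exact ⟨h a h1 (h2 ▸ hn), h2⟩
  · rintro ⟨h1, h2⟩
    exact ⟨hAB h1, h2⟩

/-- The generating series is the sum of those of the fibers of a statistic `φ ≤ w`. -/
theorem X_pow_dvd_genSeries_sub_sum (hA : FiniteFibers A w) (φ : α → ℕ)
    (hφ : ∀ a ∈ A, φ a ≤ w a) (N : ℕ) :
    (X : ℚ⟦X⟧) ^ N ∣
      genSeries A w - ∑ s ∈ Finset.range N, genSeries {a | a ∈ A ∧ φ a = s} w := by
  rw [← genSeries_lt hA]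
  exact X_pow_dvd_genSeries_sub N (fun a ha => ha.1)
    fun a ha h => ⟨ha, (hφ a ha).trans_lt h⟩

theorem genSeries_prod (hA : FiniteFibers A w) (hC : FiniteFibers C v) :
    genSeries (A ×ˢ C) (fun p => w p.1 + v p.2) = genSeries A w * genSeries C v := by
  classical
  ext n
  rw [coeff_mul, coeff_genSeries]
  simp only [coeff_genSeries]
  have key : {p : α × β | p ∈ A ×ˢ C ∧ w p.1 + v p.2 = n} =
      ↑((Finset.HasAntidiagonal.antidiagonal n).biUnion fun ij =>
        (hA ij.1).toFinset ×ˢ (hC ij.2).toFinset) := by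
    ext ⟨a, c⟩
    simp only [Set.mem_ofPred_eq, Set.mem_prod, Finset.coe_biUnion, Set.mem_iUnion,
      Finset.mem_coe, Finset.HasAntidiagonal.mem_antidiagonal, Finset.mem_product, Set.Finite.mem_toFinset,
      exists_prop, Prod.exists]
    constructor
    · rintro ⟨⟨ha, hc⟩, h⟩
      exact ⟨_, _, h, ⟨ha, rfl⟩, hc, rfl⟩
    · rintro ⟨i, j, h, ⟨ha, rfl⟩, hc, rfl⟩
      exact ⟨⟨ha, hc⟩, h⟩
  rw [key, Set.ncard_coe_finset, Finset.card_biUnion]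
  · push_cast
    refine Finset.sum_congr rfl fun ij _ => ?_
    rw [Finset.card_product, Nat.cast_mul, Set.ncard_eq_toFinset_card _ (hA ij.1),
      Set.ncard_eq_toFinset_card _ (hC ij.2)]
  · rintro ⟨i, j⟩ _ ⟨i', j'⟩ _ hne
    rw [Function.onFun, Finset.disjoint_left]
    rintro ⟨a, c⟩ h h'
    simp only [Finset.mem_product, Set.Finite.mem_toFinset, Set.mem_ofPred_eq] at h h'
    exact hne (by rw [← h.1.2, ← h.2.2, h'.1.2, h'.2.2])

end genSeries

theorem eq_zero_of_X_pow_dvd {f : ℚ⟦X⟧} (h : ∀ N, X ^ N ∣ f) : f = 0 := by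
  ext n
  exact X_pow_dvd_iff.1 (h (n + 1)) n n.lt_succ_self

/-! ### Partitions with bounded smallest part -/

/-- The multisets with all parts at least `k`. -/
def partsGE (k : ℕ) : Set (Multiset ℕ) := {s | ∀ x ∈ s, k ≤ x}

theorem partsGE_mono {k l : ℕ} (h : k ≤ l) : partsGE l ⊆ partsGE k :=
  fun _ hs x hx => h.trans (hs x hx)

theorem card_mul_le_sum {k : ℕ} {s : Multiset ℕ} (hs : s ∈ partsGE k) :
    Multiset.card s * k ≤ s.sum := by
  simpa using Multiset.card_nsmul_le_sum hs

theorem card_le_sum {k : ℕ} (hk : 1 ≤ k) {s : Multiset ℕ} (hs : s ∈ partsGE k) :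
    Multiset.card s ≤ s.sum := by
  simpa using card_mul_le_sum (partsGE_mono hk hs)

theorem finiteFibers_partsGE {k : ℕ} (hk : 1 ≤ k) :
    FiniteFibers (partsGE k) Multiset.sum := by
  intro n
  refine (Set.finite_range fun p : n.Partition => p.parts).subset ?_
  rintro s ⟨hs, hn⟩
  exact ⟨⟨s, fun h => hk.trans (hs _ h), hn⟩, rfl⟩

theorem finiteFibers_of_pos {A : Set (Multiset ℕ)} (h : ∀ s ∈ A, ∀ x ∈ s, 1 ≤ x) :
    FiniteFibers A Multiset.sum :=
  (finiteFibers_partsGE le_rfl).mono h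

theorem genSeries_cons {A C : Set (Multiset ℕ)} (k : ℕ) (h : ∀ s ∈ A, k ::ₘ s ∈ C)
    (h' : ∀ s ∈ C, k ∈ s ∧ s.erase k ∈ A) :
    genSeries C Multiset.sum = X ^ k * genSeries A Multiset.sum := by
  refine genSeries_of_inverse (k ::ₘ ·) (fun s => s.erase k) k ?_ ?_
  · intro s hs
    exact ⟨h s hs, by simp, by simp [add_comm]⟩
  · intro s hs
    exact ⟨(h' s hs).2, Multiset.cons_erase (h' s hs).1⟩

/-- Partitions with all parts at least `k`. -/
noncomputable def seriesGE (k : ℕ) : ℚ⟦X⟧ := genSeries (partsGE k) Multiset.sum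

/-- Partitions containing `k` correspond to arbitrary ones in `partsGE k` by deleting one copy of
`k`. Thus `seriesGE k` is `H · (1 - q)⋯(1 - q^(k-1))` without any division. -/
theorem seriesGE_succ {k : ℕ} (hk : 1 ≤ k) : seriesGE (k + 1) = (1 - X ^ k) * seriesGE k := by
  have h1 : genSeries {s | s ∈ partsGE k ∧ k ∈ s} Multiset.sum = X ^ k * seriesGE k := by
    refine genSeries_cons k (fun s hs => ⟨?_, by simp⟩)
      fun s hs => ⟨hs.2, fun x hx => hs.1 x (Multiset.mem_of_mem_erase hx)⟩
    intro x hx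
    rcases Multiset.mem_cons.1 hx with rfl | hx
    · exact le_rfl
    · exact hs x hx
  have h2 : {s | s ∈ partsGE k ∧ k ∉ s} = partsGE (k + 1) := by
    ext s
    constructor
    · rintro ⟨h, hk⟩ x hx
      exact lt_of_le_of_ne (h x hx) (by rintro rfl; exact hk hx)
    · intro h
      exact ⟨partsGE_mono k.le_succ h, fun hk => absurd (h k hk) (by omega)⟩
  have h := genSeries_split (finiteFibers_partsGE hk) (fun s => k ∈ s)
  rw [h1, h2] at h
  change seriesGE k = _ + seriesGE (k + 1) at h
  linear_combination -h

theorem mem_cons_ge {k : ℕ} {s : Multiset ℕ} (hs : s ∈ partsGE k) : k ::ₘ s ∈ partsGE k := by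
  intro x hx
  rcases Multiset.mem_cons.1 hx with rfl | hx
  · exact le_rfl
  · exact hs x hx

/-! ### Box partitions and Gaussian binomials -/

/-- Partitions with exactly `a` parts, all in `[1, i]`. -/
noncomputable def seriesBox (a i : ℕ) : ℚ⟦X⟧ :=
  genSeries {s : Multiset ℕ | s.card = a ∧ ∀ x ∈ s, 1 ≤ x ∧ x ≤ i} Multiset.sum

theorem seriesBox_zero_left (i : ℕ) : seriesBox 0 i = 1 := by
  have : {s : Multiset ℕ | s.card = 0 ∧ ∀ x ∈ s, 1 ≤ x ∧ x ≤ i} = {0} := by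
    ext s
    simp only [Set.mem_ofPred_eq, Multiset.card_eq_zero, Set.mem_singleton_iff,
      and_iff_left_iff_imp]
    rintro rfl
    simp
  rw [seriesBox, this, genSeries_singleton]
  simp

theorem seriesBox_succ_zero (a : ℕ) : seriesBox (a + 1) 0 = 0 := by
  have : {s : Multiset ℕ | s.card = a + 1 ∧ ∀ x ∈ s, 1 ≤ x ∧ x ≤ 0} = ∅ := by
    ext s
    simp only [Set.mem_ofPred_eq, Set.mem_empty_iff_false, iff_false, not_and]
    intro h h'
    obtain ⟨x, hx⟩ := Multiset.card_pos_iff_exists_mem.1 (by omega : 0 < s.card)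
    have := h' x hx
    omega
  rw [seriesBox, this, genSeries_empty]

/-- The `q`-Pascal rule: either the maximal size `i + 1` is absent, or one copy of it can be
removed. -/
theorem seriesBox_succ_succ (a i : ℕ) :
    seriesBox (a + 1) (i + 1) = seriesBox (a + 1) i + X ^ (i + 1) * seriesBox a (i + 1) := by
  rw [seriesBox, genSeries_split (finiteFibers_of_pos fun s hs x hx => (hs.2 x hx).1)
    (fun s => i + 1 ∈ s), add_comm]
  congr 1
  · rw [seriesBox]
    congr 1
    ext s
    constructor
    · rintro ⟨⟨h1, h2⟩, h3⟩
      refine ⟨h1, fun x hx => ⟨(h2 x hx).1, ?_⟩⟩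
      exact Nat.le_of_lt_succ (lt_of_le_of_ne (h2 x hx).2 (by rintro rfl; exact h3 hx))
    · rintro ⟨h1, h2⟩
      exact ⟨⟨h1, fun x hx => ⟨(h2 x hx).1, (h2 x hx).2.trans i.le_succ⟩⟩,
        fun h => absurd (h2 _ h).2 (by omega)⟩
  · refine genSeries_cons (i + 1) ?_ ?_
    · rintro s ⟨h1, h2⟩
      refine ⟨⟨by simp [h1], fun x hx => ?_⟩, by simp⟩
      rcases Multiset.mem_cons.1 hx with rfl | hx
      · omega
      · exact h2 x hx
    · rintro s ⟨⟨h1, h2⟩, h3⟩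
      refine ⟨h3, ?_, fun x hx => h2 x (Multiset.mem_of_mem_erase hx)⟩
      rw [Multiset.card_erase_of_mem h3, h1]
      rfl

/-- The Gaussian binomial coefficient formula, cleared of denominators. -/
theorem seriesBox_mul (a i : ℕ) : seriesBox a (i + 1) * seriesGE (a + 1) * seriesGE (i + 1) =
    X ^ a * seriesGE 1 * seriesGE (a + i + 1) := by
  induction a generalizing i with
  | zero => simp [seriesBox_zero_left]
  | succ a iha =>
    induction i with
    | zero =>
      have h := iha 0
      rw [seriesBox_succ_succ, seriesBox_succ_zero, seriesGE_succ (k := a + 1) (by omega)]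
      simp only [add_zero, zero_add] at h ⊢
      linear_combination X * (1 - X ^ (a + 1)) * h
    | succ i ihi =>
      have h := iha (i + 1)
      have h1 := seriesGE_succ (k := a + 1) (by omega)
      have h2 := seriesGE_succ (k := i + 1) (by omega)
      have h3 := seriesGE_succ (k := a + i + 1 + 1) (by omega)
      have e1 : a + (i + 1) + 1 = a + i + 1 + 1 := by omega
      have e2 : a + 1 + i + 1 = a + i + 1 + 1 := by omega
      have e3 : a + 1 + (i + 1) + 1 = a + i + 1 + 1 + 1 := by omega
      rw [e1] at h
      rw [e2] at ihi
      rw [e3, h3, seriesBox_succ_succ]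
      -- The two Pascal terms combine through `(1 - X^(i+1)) + X^(i+1) (1 - X^(a+1)) = 1 -
      -- X^(a+i+2)`, the factor that `h3` extracts.
      linear_combination (1 - X ^ (i + 1)) * ihi + X ^ (i + 2) * (1 - X ^ (a + 1)) * h +
        seriesBox (a + 1) (i + 1) * seriesGE (a + 1 + 1) * h2 +
        X ^ (i + 2) * seriesBox a (i + 2) * seriesGE (i + 2) * h1

/-! ### Partitions with a fixed number of parts -/

/-- Multisets of exactly `j` parts, all at least `k`. -/
noncomputable def seriesCard (j k : ℕ) : ℚ⟦X⟧ :=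
  genSeries {s | s ∈ partsGE k ∧ s.card = j} Multiset.sum

theorem sum_map_add (s : Multiset ℕ) (c : ℕ) :
    (s.map (· + c)).sum = s.sum + s.card * c := by
  simp [Multiset.sum_map_add]

theorem map_sub_map_add (s : Multiset ℕ) (c : ℕ) : (s.map (· + c)).map (· - c) = s := by
  simp

theorem map_add_map_sub {s : Multiset ℕ} {c : ℕ} (hs : s ∈ partsGE c) :
    (s.map (· - c)).map (· + c) = s := by
  rw [Multiset.map_map]
  conv_rhs => rw [← Multiset.map_id s]
  exact Multiset.map_congr rfl fun x hx => Nat.sub_add_cancel (hs x hx)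

theorem seriesCard_eq (j k : ℕ) : seriesCard j k = X ^ (j * k) * seriesCard j 0 := by
  refine genSeries_of_inverse (fun s => s.map (· + k)) (fun s => s.map (· - k)) _ ?_ ?_
  · rintro s ⟨-, hs⟩
    refine ⟨⟨?_, by simpa using hs⟩, map_sub_map_add s k, by simp only [sum_map_add, hs]⟩
    intro x hx
    obtain ⟨y, -, rfl⟩ := Multiset.mem_map.1 hx
    exact Nat.le_add_left k y
  · rintro s ⟨hs, hc⟩
    exact ⟨⟨fun x _ => Nat.zero_le x, by simpa using hc⟩, map_add_map_sub hs⟩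

theorem seriesCard_zero (k : ℕ) : seriesCard 0 k = 1 := by
  have : {s | s ∈ partsGE k ∧ s.card = 0} = {0} := by
    ext s
    simp only [Set.mem_ofPred_eq, Multiset.card_eq_zero, Set.mem_singleton_iff,
      and_iff_right_iff_imp]
    rintro rfl x hx
    simp at hx
  rw [seriesCard, this, genSeries_singleton]
  simp

/-- With zero parts allowed, `seriesCard j 0` is `1 / ((1 - q)⋯(1 - q^j))`. The recursion comes from
splitting `j + 1` positive parts by the presence of a part `1`, shifting all three families down to
parts at least `0`, and cancelling `X^(j+1)`. -/
theorem seriesCard_succ (j : ℕ) : seriesCard j 0 = (1 - X ^ (j + 1)) * seriesCard (j + 1) 0 := by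
  have h : seriesCard (j + 1) 1 = X ^ 1 * seriesCard j 1 + seriesCard (j + 1) 2 := by
    rw [seriesCard, genSeries_split (finiteFibers_of_pos fun s hs => hs.1) (fun s => 1 ∈ s)]
    congr 1
    · refine genSeries_cons 1 ?_ ?_
      · rintro s ⟨hs, hc⟩
        exact ⟨⟨mem_cons_ge hs, by simp [hc]⟩, by simp⟩
      · rintro s ⟨⟨hs, hc⟩, h1⟩
        refine ⟨h1, fun x hx => hs x (Multiset.mem_of_mem_erase hx), ?_⟩
        rw [Multiset.card_erase_of_mem h1, hc]
        rfl
    · rw [seriesCard]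
      congr 1
      ext s
      constructor
      · rintro ⟨⟨hs, hc⟩, h1⟩
        exact ⟨fun x hx => lt_of_le_of_ne (hs x hx) (by rintro rfl; exact h1 hx), hc⟩
      · rintro ⟨hs, hc⟩
        exact ⟨⟨partsGE_mono one_le_two hs, hc⟩, fun h1 => absurd (hs 1 h1) (by omega)⟩
  rw [seriesCard_eq, seriesCard_eq (j + 1) 2, seriesCard_eq j 1] at h
  have hX : (X : ℚ⟦X⟧) ^ (j + 1) ≠ 0 := pow_ne_zero _ X_ne_zero
  refine mul_left_cancel₀ hX ?_
  linear_combination -h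

/-- Discarding zeros, `seriesCard j 0` counts partitions into at most `j` positive parts, which is
no restriction on sizes up to `j`. -/
theorem X_pow_dvd_seriesGE_one_sub_seriesCard (j : ℕ) :
    (X : ℚ⟦X⟧) ^ (j + 1) ∣ seriesGE 1 - seriesCard j 0 := by
  have hU : ∀ j, seriesCard j 0 =
      genSeries {s | s ∈ partsGE 1 ∧ s.card < j + 1} Multiset.sum := by
    intro j
    induction j with
    | zero =>
      rw [genSeries_lt (finiteFibers_partsGE le_rfl), Finset.sum_range_one]
      change _ = seriesCard 0 1
      rw [seriesCard_zero, seriesCard_zero]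
    | succ j ih =>
      rw [genSeries_lt (finiteFibers_partsGE le_rfl), Finset.sum_range_succ,
        ← genSeries_lt (finiteFibers_partsGE le_rfl), ← ih]
      change _ = _ + seriesCard (j + 1) 1
      rw [seriesCard_eq (j + 1) 1, seriesCard_succ j]
      ring
  rw [hU]
  exact X_pow_dvd_genSeries_sub _ (fun s hs => hs.1)
    fun s hs h => ⟨hs, (card_le_sum le_rfl hs).trans_lt h⟩

theorem seriesH_eq : seriesH = seriesGE 1 := by
  ext n
  rw [seriesH, coeff_mk, seriesGE, coeff_genSeries, ← Nat.card_eq_fintype_card,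
    ← Nat.card_coe_set_eq]
  congr 1
  exact Nat.card_congr
    { toFun := fun p => ⟨p.parts, fun _ hx => p.parts_pos hx, p.parts_sum⟩
      invFun := fun s => ⟨s.1, fun {x} hx => s.2.1 x hx, s.2.2⟩
      left_inv := fun _ => rfl
      right_inv := fun _ => rfl }

/-! ### Gordon partitions by multiplicities -/

/-- Gordon's conditions in terms of multiplicities, for parts larger than `j`: two consecutive
sizes together occur fewer than `r` times, and `j + 1` occurs fewer than `i` times. -/
def gordonParts (r i j : ℕ) : Set (Multiset ℕ) :=
  {s | (∀ x ∈ s, j < x) ∧ (∀ x, s.count x + s.count (x + 1) < r) ∧ s.count (j + 1) < i}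

noncomputable def seriesGordon (r i j : ℕ) : ℚ⟦X⟧ :=
  genSeries (gordonParts r i j) Multiset.sum

theorem gordonParts_subset (r i j : ℕ) : gordonParts r i j ⊆ partsGE (j + 1) :=
  fun _ hs => hs.1

theorem finiteFibers_gordonParts (r i j : ℕ) : FiniteFibers (gordonParts r i j) Multiset.sum :=
  (finiteFibers_partsGE (by omega)).mono (gordonParts_subset r i j)

theorem replicate_add_filter (s : Multiset ℕ) (x : ℕ) :
    Multiset.replicate (s.count x) x + s.filter (· ≠ x) = s := by
  rw [← Multiset.filter_eq', Multiset.filter_add_not]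

theorem filter_replicate_add {s : Multiset ℕ} {x : ℕ} (a : ℕ) (h : x ∉ s) :
    (Multiset.replicate a x + s).filter (· ≠ x) = s := by
  rw [Multiset.filter_add, Multiset.filter_eq_nil.2, zero_add, Multiset.filter_eq_self]
  · rintro y hy rfl
    exact h hy
  · intro y hy
    simpa using Multiset.eq_of_mem_replicate hy

theorem count_replicate_add {s : Multiset ℕ} {x : ℕ} (a : ℕ) (h : x ∉ s) :
    (Multiset.replicate a x + s).count x = a := by
  simp [h]

theorem notMem_of_mem_gordonParts {r i j x : ℕ} {s : Multiset ℕ} (hs : s ∈ gordonParts r i j)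
    (hx : x ≤ j) : x ∉ s :=
  fun h => absurd (hs.1 x h) (by omega)

theorem replicate_add_mem_gordonParts {r i j a : ℕ} {s : Multiset ℕ} (ha : a < r) (hi : a < i)
    (hs : s ∈ gordonParts r (r - a) (j + 1)) :
    Multiset.replicate a (j + 1) + s ∈ gordonParts r i j := by
  have h1 : j + 1 ∉ s := notMem_of_mem_gordonParts hs le_rfl
  have h0 : j ∉ s := notMem_of_mem_gordonParts hs (by omega)
  refine ⟨fun x hx => ?_, fun x => ?_, by rwa [count_replicate_add a h1]⟩
  · rcases Multiset.mem_add.1 hx with hx | hx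
    · rw [Multiset.eq_of_mem_replicate hx]
      omega
    · have := hs.1 x hx
      omega
  · have h2 := hs.2.1 x
    have h3 := hs.2.2
    simp only [Multiset.count_add, Multiset.count_replicate]
    rcases eq_or_ne x j with rfl | hxj
    · rw [Multiset.count_eq_zero_of_notMem h0, Multiset.count_eq_zero_of_notMem h1]
      simpa using ha
    · rcases eq_or_ne x (j + 1) with rfl | hxj'
      · rw [Multiset.count_eq_zero_of_notMem h1]
        simp only [if_true, add_zero, if_neg (show j + 1 ≠ j + 1 + 1 by omega)]
        omega
      · rw [if_neg (by omega), if_neg (by omega)]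
        omega

theorem filter_mem_gordonParts {r i j : ℕ} {s : Multiset ℕ} (hs : s ∈ gordonParts r i j) :
    s.filter (· ≠ j + 1) ∈ gordonParts r (r - s.count (j + 1)) (j + 1) := by
  refine ⟨fun x hx => ?_, fun x => ?_, ?_⟩
  · rw [Multiset.mem_filter] at hx
    have := hs.1 x hx.1
    omega
  · exact (add_le_add (Multiset.count_le_of_le _ (Multiset.filter_le _ _))
      (Multiset.count_le_of_le _ (Multiset.filter_le _ _))).trans_lt (hs.2.1 x)
  · have := hs.2.1 (j + 1)
    have := Multiset.count_le_of_le (j + 1 + 1) (Multiset.filter_le (· ≠ j + 1) s)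
    omega

theorem map_add_mem_gordonParts {r i j : ℕ} {s : Multiset ℕ} (c : ℕ) (hr : 0 < r)
    (hs : s ∈ gordonParts r i j) : s.map (· + c) ∈ gordonParts r i (j + c) := by
  have hc : ∀ x, (s.map (· + c)).count (x + c) = s.count x := fun x =>
    Multiset.count_map_eq_count' (· + c) s (add_left_injective c) x
  have h0 : ∀ x, x ≤ j + c → (s.map (· + c)).count x = 0 := by
    intro x hx
    refine Multiset.count_eq_zero_of_notMem fun h => ?_
    obtain ⟨y, hy, rfl⟩ := Multiset.mem_map.1 h
    have := hs.1 y hy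
    omega
  refine ⟨fun x hx => ?_, fun x => ?_, ?_⟩
  · obtain ⟨y, hy, rfl⟩ := Multiset.mem_map.1 hx
    have := hs.1 y hy
    omega
  · rcases le_or_gt c x with h | h
    · obtain ⟨y, rfl⟩ := Nat.exists_eq_add_of_le' h
      rw [hc, add_right_comm, hc]
      exact hs.2.1 y
    · rw [h0 _ (by omega), h0 _ (by omega)]
      exact hr
  · rw [add_right_comm, hc]
    exact hs.2.2

theorem map_sub_mem_gordonParts {r i j c : ℕ} {s : Multiset ℕ}
    (hs : s ∈ gordonParts r i (j + c)) : s.map (· - c) ∈ gordonParts r i j := by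
  have hc : ∀ x, (s.map (· - c)).count x = s.count (x + c) := by
    intro x
    have h := map_add_map_sub (s := s) (c := c) fun y hy => by
      have := hs.1 y hy
      omega
    conv_rhs => rw [← h]
    exact (Multiset.count_map_eq_count' (· + c) _ (add_left_injective c) x).symm
  refine ⟨fun x hx => ?_, fun x => ?_, ?_⟩
  · obtain ⟨y, hy, rfl⟩ := Multiset.mem_map.1 hx
    have := hs.1 y hy
    omega
  · rw [hc, hc, add_right_comm]
    exact hs.2.1 _
  · rw [hc, add_right_comm]
    exact hs.2.2

theorem seriesGordon_zero (r j : ℕ) : seriesGordon r 0 j = 0 := by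
  have : gordonParts r 0 j = ∅ := by
    ext s
    simp [gordonParts]
  rw [seriesGordon, this, genSeries_empty]

/-- The new partitions have exactly `a` copies of `j + 1`. Removing these leaves parts above `j +
1`, and the bound on consecutive multiplicities becomes fewer than `r - a` copies of `j + 2`. -/
theorem seriesGordon_succ {r a : ℕ} (j : ℕ) (ha : a < r) : seriesGordon r (a + 1) j =
    seriesGordon r a j + X ^ (a * (j + 1)) * seriesGordon r (r - a) (j + 1) := by
  rw [seriesGordon, genSeries_split (finiteFibers_gordonParts _ _ _)
    (fun s => s.count (j + 1) < a)]
  congr 1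
  · rw [seriesGordon]
    congr 1
    ext s
    constructor
    · rintro ⟨⟨h1, h2, -⟩, h4⟩
      exact ⟨h1, h2, h4⟩
    · rintro ⟨h1, h2, h3⟩
      exact ⟨⟨h1, h2, h3.trans a.lt_succ_self⟩, h3⟩
  · refine genSeries_of_inverse (Multiset.replicate a (j + 1) + ·)
      (fun s => s.filter (· ≠ j + 1)) _ ?_ ?_
    · intro s hs
      have h := notMem_of_mem_gordonParts hs le_rfl
      refine ⟨⟨replicate_add_mem_gordonParts ha a.lt_succ_self hs, ?_⟩,
        filter_replicate_add a h, ?_⟩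
      · rw [count_replicate_add a h]
        exact lt_irrefl a
      · simp [add_comm]
    · rintro s ⟨hs, hc⟩
      have hc : s.count (j + 1) = a := by
        have := hs.2.2
        omega
      have h1 := filter_mem_gordonParts hs
      have h2 := replicate_add_filter s (j + 1)
      rw [hc] at h1 h2
      exact ⟨h1, h2⟩

theorem X_pow_dvd_seriesGordon_sub_one {r i : ℕ} (hr : 0 < r) (hi : 0 < i) (j : ℕ) :
    (X : ℚ⟦X⟧) ^ (j + 1) ∣ seriesGordon r i j - 1 := by
  have h : (1 : ℚ⟦X⟧) = genSeries {(0 : Multiset ℕ)} Multiset.sum := by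
    rw [genSeries_singleton]
    simp
  rw [h]
  refine X_pow_dvd_genSeries_sub _ ?_ ?_
  · rintro s rfl
    exact ⟨by simp, by simpa using hr, by simpa using hi⟩
  · intro s hs hlt
    rw [Set.mem_singleton_iff, ← Multiset.card_eq_zero]
    have := card_mul_le_sum (gordonParts_subset _ _ _ hs)
    by_contra h0
    have : 1 * (j + 1) ≤ s.card * (j + 1) := Nat.mul_le_mul_right _ (by omega)
    omega

/-! ### Telescoping sum over the number of parts -/

/-- Abel summation, isolated for the inductive step of `sum_seriesCard_mul_seriesGordon`, where `y =
X^(M+1)` and `f a = seriesGordon r a (M + 1)`. -/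
theorem sum_abel {R : Type*} [CommRing R] (f : ℕ → R) (hf : f 0 = 0) (y : R) (r : ℕ) :
    ∑ a ∈ Finset.range r, y ^ (r - a) * (f (a + 1) - f a) +
      (1 - y) * ∑ a ∈ Finset.range r, y ^ a * f (r - a) = f r := by
  induction r with
  | zero => simp [hf]
  | succ r ih =>
    have h1 : ∑ a ∈ Finset.range r, y ^ (r + 1 - a) * (f (a + 1) - f a) =
        y * ∑ a ∈ Finset.range r, y ^ (r - a) * (f (a + 1) - f a) := by
      rw [Finset.mul_sum]
      refine Finset.sum_congr rfl fun a ha => ?_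
      rw [Nat.succ_sub (Finset.mem_range.1 ha).le, pow_succ]
      ring
    have h2 : ∑ a ∈ Finset.range r, y ^ (a + 1) * f (r + 1 - (a + 1)) =
        y * ∑ a ∈ Finset.range r, y ^ a * f (r - a) := by
      rw [Finset.mul_sum]
      refine Finset.sum_congr rfl fun a _ => ?_
      rw [Nat.add_sub_add_right, pow_succ]
      ring
    rw [Finset.sum_range_succ, h1, Finset.sum_range_succ', h2]
    simp only [Nat.add_sub_cancel_left, pow_one, pow_zero, one_mul, Nat.sub_zero]
    linear_combination y * ih

theorem sum_seriesGordon {r : ℕ} (j : ℕ) :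
    ∑ a ∈ Finset.range r, X ^ (a * (j + 1)) * seriesGordon r (r - a) (j + 1) =
      seriesGordon r r j := by
  have h : ∀ i ≤ r,
      ∑ a ∈ Finset.range i, X ^ (a * (j + 1)) * seriesGordon r (r - a) (j + 1) =
        seriesGordon r i j := by
    intro i hi
    induction i with
    | zero => simp [seriesGordon_zero]
    | succ i ih => rw [Finset.sum_range_succ, ih (by omega), ← seriesGordon_succ j hi]
  exact h r le_rfl

/-- The partial sums have a closed form. As `M` grows, its first factor tends to `1` and its second
to the series of all partitions. -/
theorem sum_seriesCard_mul_seriesGordon (r M : ℕ) :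
    ∑ j ∈ Finset.range (M + 1), ∑ a ∈ Finset.range r,
        X ^ a * (seriesCard j r * seriesGordon r (r - a) (j + 1)) =
      seriesGordon r r M * seriesCard M 0 := by
  induction M with
  | zero =>
    rw [Finset.sum_range_one, ← sum_seriesGordon, Finset.sum_mul]
    refine Finset.sum_congr rfl fun a _ => ?_
    rw [seriesCard_zero, seriesCard_zero]
    simp
  | succ M ih =>
    rw [Finset.sum_range_succ, ih, seriesCard_succ, ← sum_seriesGordon (r := r) M]
    have h := sum_abel (fun a => seriesGordon r a (M + 1)) (seriesGordon_zero r _)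
      (X ^ (M + 1)) r
    have h1 : ∑ a ∈ Finset.range r,
        X ^ a * (seriesCard (M + 1) r * seriesGordon r (r - a) (M + 1 + 1)) =
        (∑ a ∈ Finset.range r, ((X : ℚ⟦X⟧) ^ (M + 1)) ^ (r - a) *
          (seriesGordon r (a + 1) (M + 1) - seriesGordon r a (M + 1))) *
            seriesCard (M + 1) 0 := by
      rw [Finset.sum_mul]
      refine Finset.sum_congr rfl fun a ha => ?_
      have ha := Finset.mem_range.1 ha
      obtain ⟨b, rfl⟩ := Nat.exists_eq_add_of_le ha.le
      -- The exponents agree: `a + (M+1) r = (M+1)(r-a) + a(M+2)`.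
      rw [seriesCard_eq, seriesGordon_succ _ ha, Nat.add_sub_cancel_left]
      ring
    have h2 : ∑ a ∈ Finset.range r, X ^ (a * (M + 1)) * seriesGordon r (r - a) (M + 1) =
        ∑ a ∈ Finset.range r, ((X : ℚ⟦X⟧) ^ (M + 1)) ^ a * seriesGordon r (r - a) (M + 1) := by
      refine Finset.sum_congr rfl fun a _ => ?_
      rw [← pow_mul, mul_comm a]
    rw [h1, h2]
    linear_combination seriesCard (M + 1) 0 * h

/-! ### Separated pairs are counted by all partitions -/

/-- The number of parts different from `1`. -/
def restCard (s : Multiset ℕ) : ℕ := (s.filter (· ≠ 1)).card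

/-- The pairs of a partition and a Gordon partition `g` such that all parts of the first one are
at least `restCard g + r`. -/
def separatedPairs (r : ℕ) : Set (Multiset ℕ × Multiset ℕ) :=
  {p | p.2 ∈ gordonParts r r 0 ∧ p.1 ∈ partsGE (restCard p.2 + r)}

/-- The total size of a pair. -/
def pairSum (p : Multiset ℕ × Multiset ℕ) : ℕ := p.1.sum + p.2.sum

theorem finiteFibers_separatedPairs {r : ℕ} (hr : 1 ≤ r) :
    FiniteFibers (separatedPairs r) pairSum :=
  ((finiteFibers_partsGE le_rfl).prod (finiteFibers_partsGE le_rfl)).mono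
    fun _ hp => ⟨partsGE_mono (by omega) hp.2, gordonParts_subset _ _ _ hp.1⟩

/-- The `j` parts of `P` each exchange `restCard g` with the non-`1` parts of `g`, which each
exchange `j`: both amounts are `j · restCard g`. Afterwards the bound on `P` is just `r`,
independent of `g`, and the `a` ones survive as the factor `X ^ a` and the bound `r - a`. -/
theorem genSeries_separatedPairs_card {r a j : ℕ} (ha : a < r) :
    genSeries {p | (p ∈ separatedPairs r ∧ p.1.card = j) ∧ p.2.count 1 = a} pairSum =
      X ^ a * (seriesCard j r * seriesGordon r (r - a) (j + 1)) := by
  rw [seriesCard, seriesGordon, ← genSeries_prod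
    (finiteFibers_of_pos fun s hs x hx => (Nat.zero_lt_of_lt ha).trans_le (hs.1 x hx))
    (finiteFibers_gordonParts _ _ _)]
  refine genSeries_of_inverse
    (fun p => (p.1.map (· + p.2.card), Multiset.replicate a 1 + p.2.map (· - j)))
    (fun p => (p.1.map (· - restCard p.2), (p.2.filter (· ≠ 1)).map (· + j))) a ?_ ?_
  · rintro ⟨P, g⟩ ⟨⟨hP, hPj⟩, hg⟩
    simp only at hP hPj hg
    rw [add_comm j 1] at hg
    have hg' := map_sub_mem_gordonParts hg
    have h1 := notMem_of_mem_gordonParts hg' le_rfl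
    have hback : (g.map (· - j)).map (· + j) = g := map_add_map_sub fun x hx => by
      have := hg.1 x hx
      omega
    have hf := filter_replicate_add a h1
    have hrest : restCard (Multiset.replicate a 1 + g.map (· - j)) = g.card := by
      rw [restCard, hf, Multiset.card_map]
    refine ⟨⟨⟨⟨replicate_add_mem_gordonParts ha ha hg', ?_⟩, ?_⟩, ?_⟩, ?_, ?_⟩
    · intro x hx
      simp only [hrest] at hx ⊢
      obtain ⟨y, hy, rfl⟩ := Multiset.mem_map.1 hx
      have := hP y hy
      omega
    · simpa using hPj
    · exact count_replicate_add a h1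
    · simp only [hrest, hf, hback, map_sub_map_add]
    · have := sum_map_add (g.map (· - j)) j
      rw [hback, Multiset.card_map] at this
      simp only [pairSum, sum_map_add, Multiset.sum_add, Multiset.sum_replicate, smul_eq_mul,
        mul_one, hPj]
      rw [this]
      ring
  · rintro ⟨P, g⟩ ⟨⟨⟨hg, hP⟩, hPj⟩, hga⟩
    simp only at hP hPj hg hga
    have h1 := filter_mem_gordonParts hg
    have h2 := replicate_add_filter g 1
    rw [zero_add, hga] at h1
    rw [hga] at h2
    refine ⟨⟨⟨?_, by simpa using hPj⟩, ?_⟩, ?_⟩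
    · intro x hx
      obtain ⟨y, hy, rfl⟩ := Multiset.mem_map.1 hx
      have := hP y hy
      simp only
      omega
    · simp only
      rw [add_comm j]
      exact map_add_mem_gordonParts j (by omega) h1
    · have hP' : P ∈ partsGE (restCard g) := partsGE_mono (Nat.le_add_right _ _) hP
      simp only [map_sub_map_add, h2, Multiset.card_map]
      rw [show (g.filter (· ≠ 1)).card = restCard g from rfl, map_add_map_sub hP']

/-- Separated pairs are equinumerous with partitions. -/
theorem genSeries_separatedPairs {r : ℕ} (hr : 1 ≤ r) :
    genSeries (separatedPairs r) pairSum = seriesGE 1 := by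
  rw [← sub_eq_zero]
  refine eq_zero_of_X_pow_dvd fun N => ?_
  -- Working modulo `X^(N+1)` matches the sum over `j ≤ N` and both limit estimates at `N`.
  refine (pow_dvd_pow X N.le_succ).trans ?_
  have h1 := X_pow_dvd_genSeries_sub_sum (finiteFibers_separatedPairs hr) (fun p => p.1.card)
    (fun p hp => (card_le_sum (by omega) hp.2).trans (Nat.le_add_right _ _)) (N + 1)
  have h2 : ∑ j ∈ Finset.range (N + 1),
      genSeries {p | p ∈ separatedPairs r ∧ p.1.card = j} pairSum =
        seriesGordon r r N * seriesCard N 0 := by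
    rw [← sum_seriesCard_mul_seriesGordon]
    refine Finset.sum_congr rfl fun j _ => ?_
    have hlt := genSeries_lt (A := {p | p ∈ separatedPairs r ∧ p.1.card = j}) (w := pairSum)
      ((finiteFibers_separatedPairs hr).mono fun p hp => hp.1) (fun p => p.2.count 1) r
    rw [← Finset.sum_congr rfl fun a ha =>
      genSeries_separatedPairs_card (Finset.mem_range.1 ha)]
    -- A Gordon partition has fewer than `r` ones, so `a < r` exhausts all cases.
    refine Eq.trans ?_ hlt
    congr 1
    ext p
    constructor
    · intro hp
      exact ⟨hp, hp.1.1.2.2⟩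
    · exact fun hp => hp.1
  rw [h2] at h1
  have h3 := (X_pow_dvd_seriesGordon_sub_one hr hr N).mul_right (seriesCard N 0)
  have h4 := X_pow_dvd_seriesGE_one_sub_seriesCard N
  convert (h1.add h3).sub h4 using 1
  ring

/-- Partitions in `𝓑_{r,r}` with `restCard + r ≤ s`. -/
noncomputable def seriesGordonRest (r s : ℕ) : ℚ⟦X⟧ :=
  genSeries {g | g ∈ gordonParts r r 0 ∧ restCard g + r ≤ s} Multiset.sum

/-! ### Smallest and `k`-th smallest parts -/

theorem smallest_mem_and_le {s : Multiset ℕ} (hs : s ≠ 0) :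
    smallest s ∈ s ∧ s ∈ partsGE (smallest s) := by
  have hp := Multiset.pairwise_sort s (· ≤ ·)
  have he := Multiset.sort_eq s (· ≤ ·)
  rw [smallest, kthSmallest]
  cases h : s.sort (· ≤ ·) with
  | nil =>
    rw [h] at he
    exact absurd he.symm hs
  | cons a l =>
    rw [h] at hp he
    rw [← he]
    refine ⟨by simp, fun x hx => ?_⟩
    rcases List.mem_cons.1 (Multiset.mem_coe.1 hx) with rfl | hx
    · simp
    · simpa using (List.pairwise_cons.1 hp).1 x hx

theorem smallest_eq {s : Multiset ℕ} {k : ℕ} (hk : k ∈ s) (hs : s ∈ partsGE k) :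
    smallest s = k := by
  have h := smallest_mem_and_le (s := s) (by rintro rfl; simp at hk)
  exact le_antisymm (h.2 k hk) (hs _ h.1)

theorem smallest_cons {s : Multiset ℕ} {k : ℕ} (hs : s ∈ partsGE k) :
    smallest (k ::ₘ s) = k :=
  smallest_eq (by simp) (mem_cons_ge hs)

theorem sort_add_cons {A C : Multiset ℕ} {i : ℕ} (hA : ∀ x ∈ A, x ≤ i) (hC : ∀ x ∈ C, i ≤ x) :
    (A + i ::ₘ C).sort (· ≤ ·) = A.sort (· ≤ ·) ++ i :: C.sort (· ≤ ·) := by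
  refine List.Perm.eq_of_pairwise' (r := (· ≤ ·)) (Multiset.pairwise_sort _ _) ?_ ?_
  · rw [List.pairwise_append, List.pairwise_cons]
    refine ⟨Multiset.pairwise_sort _ _, ⟨by simpa using hC, Multiset.pairwise_sort _ _⟩, ?_⟩
    intro a ha b hb
    rw [Multiset.mem_sort] at ha
    rcases List.mem_cons.1 hb with rfl | hb
    · exact hA a ha
    · exact (hA a ha).trans (hC b ((Multiset.mem_sort _).1 hb))
  · rw [← Multiset.coe_eq_coe, Multiset.sort_eq, ← Multiset.coe_add, ← Multiset.cons_coe,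
      Multiset.sort_eq, Multiset.sort_eq]

theorem kthSmallest_add_cons {A C : Multiset ℕ} {i : ℕ} (hA : ∀ x ∈ A, x ≤ i)
    (hC : ∀ x ∈ C, i ≤ x) : kthSmallest (A + i ::ₘ C) (A.card + 1) = i := by
  rw [kthSmallest, sort_add_cons hA hC, List.getD_append_right _ _ _ _ (by simp)]
  simp

/-- The `n` smallest parts. -/
def lowerParts (s : Multiset ℕ) (n : ℕ) : Multiset ℕ := ↑((s.sort (· ≤ ·)).take n)

/-- All but the `n` smallest parts. -/
def upperParts (s : Multiset ℕ) (n : ℕ) : Multiset ℕ := ↑((s.sort (· ≤ ·)).drop n)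

theorem card_lowerParts {s : Multiset ℕ} {n : ℕ} (h : n < s.card) :
    (lowerParts s n).card = n := by
  simp [lowerParts, h.le]

theorem lowerParts_add_cons {s : Multiset ℕ} {n : ℕ} (h : n < s.card) :
    lowerParts s n + kthSmallest s (n + 1) ::ₘ upperParts s (n + 1) = s := by
  have hl : n < (s.sort (· ≤ ·)).length := by simpa using h
  conv_rhs => rw [← Multiset.sort_eq s (· ≤ ·), ← List.take_append_drop n (s.sort (· ≤ ·)),
    List.drop_eq_getElem_cons hl]
  rw [lowerParts, upperParts, kthSmallest, Nat.add_sub_cancel, List.getD_eq_getElem _ _ hl,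
    Multiset.cons_coe, Multiset.coe_add]

theorem lowerParts_le_and_le_upperParts {s : Multiset ℕ} {n : ℕ} (h : n < s.card) :
    (∀ x ∈ lowerParts s n, x ≤ kthSmallest s (n + 1)) ∧
      ∀ x ∈ upperParts s (n + 1), kthSmallest s (n + 1) ≤ x := by
  have hl : n < (s.sort (· ≤ ·)).length := by simpa using h
  have hp := Multiset.pairwise_sort s (· ≤ ·)
  rw [← List.take_append_drop n (s.sort (· ≤ ·)), List.drop_eq_getElem_cons hl,
    List.pairwise_append, List.pairwise_cons] at hp
  rw [kthSmallest, Nat.add_sub_cancel, List.getD_eq_getElem _ _ hl]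
  exact ⟨fun x hx => hp.2.2 x hx _ List.mem_cons_self, fun x hx => hp.2.1.1 x hx⟩

theorem kthSmallest_mem {s : Multiset ℕ} {n : ℕ} (h : n < s.card) :
    kthSmallest s (n + 1) ∈ s := by
  have h1 : kthSmallest s (n + 1) ∈
      lowerParts s n + kthSmallest s (n + 1) ::ₘ upperParts s (n + 1) := by simp
  rwa [lowerParts_add_cons h] at h1

/-- Cutting at the `(n+1)`-th smallest part leaves `n` parts in `[1, i + 1]` below and arbitrary
parts at least `i + 1` above. -/
theorem genSeries_kthSmallest (n i : ℕ) :
    genSeries {s | s ∈ partsGE 1 ∧ n + 1 ≤ s.card ∧ kthSmallest s (n + 1) = i + 1}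
      Multiset.sum = X ^ (i + 1) * (seriesBox n (i + 1) * seriesGE (i + 1)) := by
  rw [seriesBox, seriesGE, ← genSeries_prod (finiteFibers_of_pos fun s hs x hx => (hs.2 x hx).1)
    (finiteFibers_partsGE (by omega))]
  refine genSeries_of_inverse (fun p => p.1 + (i + 1) ::ₘ p.2)
    (fun s => (lowerParts s n, upperParts s (n + 1))) _ ?_ ?_
  · rintro ⟨A, C⟩ ⟨⟨hn, hA⟩, hC⟩
    simp only at hn hA hC
    have hA' : ∀ x ∈ A, x ≤ i + 1 := fun x hx => (hA x hx).2
    subst hn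
    refine ⟨⟨?_, by simp, kthSmallest_add_cons hA' hC⟩, ?_, ?_⟩
    · intro x hx
      rcases Multiset.mem_add.1 hx with hx | hx
      · exact (hA x hx).1
      · exact partsGE_mono (by omega) (mem_cons_ge hC) x hx
    · simp only [lowerParts, upperParts, sort_add_cons hA' hC]
      refine Prod.ext ?_ ?_
      · simp only
        rw [List.take_left' (by simp), Multiset.sort_eq]
      · simp only
        rw [List.append_cons, List.drop_left' (by simp), Multiset.sort_eq]
    · simp only [Multiset.sum_add, Multiset.sum_cons]
      ring
  · rintro s ⟨hs, hn, hi⟩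
    have h1 := lowerParts_add_cons (s := s) (n := n) hn
    have h2 := lowerParts_le_and_le_upperParts (s := s) (n := n) hn
    rw [hi] at h1 h2
    refine ⟨⟨⟨card_lowerParts hn, fun x hx => ⟨hs x ?_, h2.1 x hx⟩⟩, h2.2⟩, h1⟩
    rw [← h1]
    exact Multiset.mem_add.2 (Or.inl hx)

theorem genSeries_smallest (k : ℕ) :
    genSeries {s | s ∈ partsGE 1 ∧ s ≠ 0 ∧ smallest s = k + 1} Multiset.sum =
      X ^ (k + 1) * seriesGE (k + 1) := by
  refine genSeries_cons (k + 1) ?_ ?_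
  · intro s hs
    exact ⟨partsGE_mono (by omega) (mem_cons_ge hs), by simp, smallest_cons hs⟩
  · rintro s ⟨hs, h0, hk⟩
    have h := smallest_mem_and_le h0
    rw [hk] at h
    exact ⟨h.1, fun x hx => h.2 x (Multiset.mem_of_mem_erase hx)⟩

theorem genSeries_separatedPairs_smallest {r s : ℕ} (hr : 1 ≤ r) :
    genSeries {p | (p ∈ separatedPairs r ∧ p.1 ≠ 0) ∧ smallest p.1 = s} pairSum =
      X ^ s * (seriesGE s * seriesGordonRest r s) := by
  -- For `s = 0` the fibers of `partsGE 0` are infinite, so this case is separate. Both sides vanish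
  -- since `r ≥ 1`.
  rcases Nat.eq_zero_or_pos s with rfl | hs
  · have h1 : {p | (p ∈ separatedPairs r ∧ p.1 ≠ 0) ∧ smallest p.1 = 0} = ∅ := by
      ext p
      simp only [Set.mem_ofPred_eq, Set.mem_empty_iff_false, iff_false]
      rintro ⟨⟨h1, h2⟩, h3⟩
      have := h1.2 _ (smallest_mem_and_le h2).1
      omega
    have h2 : {g | g ∈ gordonParts r r 0 ∧ restCard g + r ≤ 0} = ∅ := by
      ext g
      simp only [Set.mem_ofPred_eq, Set.mem_empty_iff_false, iff_false]
      rintro ⟨-, h⟩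
      omega
    rw [h1, seriesGordonRest, h2, genSeries_empty, genSeries_empty]
    simp
  rw [seriesGE, seriesGordonRest, ← genSeries_prod (finiteFibers_partsGE hs)
    ((finiteFibers_gordonParts r r 0).mono fun g hg => hg.1)]
  refine genSeries_of_inverse (fun p => (s ::ₘ p.1, p.2)) (fun p => (p.1.erase s, p.2)) _ ?_ ?_
  · rintro ⟨P, g⟩ ⟨hP, hg, hgs⟩
    simp only at hP hg hgs
    refine ⟨⟨⟨⟨hg, partsGE_mono hgs (mem_cons_ge hP)⟩, by simp⟩, smallest_cons hP⟩, by simp, ?_⟩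
    simp only [pairSum, Multiset.sum_cons]
    ring
  · rintro ⟨P, g⟩ ⟨⟨⟨hg, hP⟩, h0⟩, hs'⟩
    simp only at hP hg h0 hs'
    have h := smallest_mem_and_le h0
    rw [hs'] at h
    exact ⟨⟨fun x hx => h.2 x (Multiset.mem_of_mem_erase hx), hg, hP s h.1⟩,
      by simp [Multiset.cons_erase h.1]⟩

/-- Separated pairs `(P, g)` are classified by the smallest part of `P`; those with `P` empty
account for the subtracted Gordon series. -/
theorem X_pow_dvd_sum_seriesGordonRest {r : ℕ} (hr : 1 ≤ r) (N : ℕ) :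
    (X : ℚ⟦X⟧) ^ N ∣ seriesGE 1 - seriesGordon r r 0 -
      ∑ s ∈ Finset.range N, X ^ s * (seriesGE s * seriesGordonRest r s) := by
  have hF := finiteFibers_separatedPairs hr
  have h := X_pow_dvd_genSeries_sub_sum (A := {p | p ∈ separatedPairs r ∧ p.1 ≠ 0})
    (w := pairSum) (hF.mono fun p hp => hp.1) (fun p => smallest p.1)
    (fun p hp => (Multiset.le_sum_of_mem (smallest_mem_and_le hp.2).1).trans
      (Nat.le_add_right _ _)) N
  have h0 : genSeries {p | p ∈ separatedPairs r ∧ p.1 = 0} pairSum = seriesGordon r r 0 := by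
    have := genSeries_of_inverse (A := gordonParts r r 0) (w := Multiset.sum)
      (C := {p | p ∈ separatedPairs r ∧ p.1 = 0}) (v := pairSum) (fun g => (0, g))
      (fun p => p.2) 0 ?_ ?_
    · rw [this, pow_zero, one_mul, seriesGordon]
    · intro g hg
      exact ⟨⟨⟨hg, by simp [partsGE]⟩, rfl⟩, rfl, by simp [pairSum]⟩
    · rintro ⟨P, g⟩ ⟨⟨hg, -⟩, rfl⟩
      exact ⟨hg, rfl⟩
  have hs := genSeries_split hF (fun p => p.1 = 0)
  rw [genSeries_separatedPairs hr, h0] at hs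
  rw [hs, add_sub_cancel_left, ← Finset.sum_congr rfl fun s _ =>
    genSeries_separatedPairs_smallest (s := s) hr]
  exact h

/-! ### Black and red parts at a given level -/

/-- The pairs `(b, d)` of a nonempty partition `b` and a partition `d` with at least `k` parts,
where `k` is the smallest part of `b`. -/
def blackRedPairs : Set (Multiset ℕ × Multiset ℕ) :=
  {p | (p.1 ∈ partsGE 1 ∧ p.1 ≠ 0) ∧ p.2 ∈ partsGE 1 ∧ smallest p.1 ≤ p.2.card}

/-- The statistic `k + i_k`. -/
def blackRedLevel (p : Multiset ℕ × Multiset ℕ) : ℕ :=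
  smallest p.1 + kthSmallest p.2 (smallest p.1)

theorem finiteFibers_blackRedPairs : FiniteFibers blackRedPairs pairSum :=
  ((finiteFibers_partsGE le_rfl).prod (finiteFibers_partsGE le_rfl)).mono
    fun _ hp => ⟨hp.1.1, hp.2.1⟩

theorem smallest_pos {s : Multiset ℕ} (h : s ∈ partsGE 1) (h0 : s ≠ 0) : 1 ≤ smallest s :=
  h _ (smallest_mem_and_le h0).1

theorem kthSmallest_mem_of_pos {s : Multiset ℕ} {k : ℕ} (hk : 1 ≤ k) (h : k ≤ s.card) :
    kthSmallest s k ∈ s := by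
  obtain ⟨n, rfl⟩ := Nat.exists_eq_add_of_le' hk
  exact kthSmallest_mem h

theorem kthSmallest_smallest_mem {p : Multiset ℕ × Multiset ℕ} (hp : p ∈ blackRedPairs) :
    kthSmallest p.2 (smallest p.1) ∈ p.2 :=
  kthSmallest_mem_of_pos (smallest_pos hp.1.1 hp.1.2) hp.2.2

theorem blackRedLevel_le {p : Multiset ℕ × Multiset ℕ} (hp : p ∈ blackRedPairs) :
    blackRedLevel p ≤ pairSum p :=
  add_le_add (Multiset.le_sum_of_mem (smallest_mem_and_le hp.1.2).1)
    (Multiset.le_sum_of_mem (kthSmallest_smallest_mem hp))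

/-- The Gaussian binomial's denominators cancel against the two `seriesGE` factors, so that, at a
fixed level, only `X ^ k` depends on `k`. -/
theorem genSeries_blackRedPairs_smallest (k i : ℕ) :
    genSeries {p | (p ∈ blackRedPairs ∧ blackRedLevel p = k + i + 2) ∧ smallest p.1 = k + 1}
      pairSum = X ^ (k + i + 2) * X ^ k * seriesGE 1 * seriesGE (k + i + 1) := by
  have h : {p | (p ∈ blackRedPairs ∧ blackRedLevel p = k + i + 2) ∧ smallest p.1 = k + 1} =
      {s | s ∈ partsGE 1 ∧ s ≠ 0 ∧ smallest s = k + 1} ×ˢ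
        {s | s ∈ partsGE 1 ∧ k + 1 ≤ s.card ∧ kthSmallest s (k + 1) = i + 1} := by
    ext ⟨b, d⟩
    simp only [blackRedPairs, blackRedLevel, Set.mem_ofPred_eq, Set.mem_prod]
    constructor
    · rintro ⟨⟨⟨⟨h1, h2⟩, h3, h4⟩, h5⟩, h6⟩
      rw [h6] at h4 h5
      exact ⟨⟨h1, h2, h6⟩, h3, h4, by omega⟩
    · rintro ⟨⟨h1, h2, h6⟩, h3, h4, h5⟩
      rw [h6]
      exact ⟨⟨⟨⟨h1, h2⟩, h3, h4⟩, by omega⟩, rfl⟩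
  rw [h]
  have hp := genSeries_prod (A := {s | s ∈ partsGE 1 ∧ s ≠ 0 ∧ smallest s = k + 1})
    (C := {s | s ∈ partsGE 1 ∧ k + 1 ≤ s.card ∧ kthSmallest s (k + 1) = i + 1})
    (finiteFibers_of_pos fun s hs => hs.1) (finiteFibers_of_pos fun s hs => hs.1)
  change genSeries _ pairSum = _ at hp
  rw [hp, genSeries_smallest, genSeries_kthSmallest]
  linear_combination X ^ (k + i + 2) * seriesBox_mul k i

theorem genSeries_blackRedPairs_level {n : ℕ} (hn : 1 ≤ n) :
    (1 - X) * genSeries {p | p ∈ blackRedPairs ∧ blackRedLevel p = n + 1} pairSum =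
      X ^ (n + 1) * seriesGE 1 * seriesGE (n + 1) := by
  have hlt := genSeries_lt (A := {p | p ∈ blackRedPairs ∧ blackRedLevel p = n + 1})
    (w := pairSum) (finiteFibers_blackRedPairs.mono fun p hp => hp.1)
    (fun p => smallest p.1) (n + 1)
  have hset : {p | p ∈ {p | p ∈ blackRedPairs ∧ blackRedLevel p = n + 1} ∧
      smallest p.1 < n + 1} = {p | p ∈ blackRedPairs ∧ blackRedLevel p = n + 1} := by
    ext p
    constructor
    · exact fun hp => hp.1
    · intro hp
      refine ⟨hp, ?_⟩
      -- The red part is at least `1`, so the smallest black part is at most `n`.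
      have h1 := hp.1.2.1 _ (kthSmallest_smallest_mem hp.1)
      have h2 := hp.2
      rw [blackRedLevel] at h2
      omega
  have h0 : {p | p ∈ {p | p ∈ blackRedPairs ∧ blackRedLevel p = n + 1} ∧
      smallest p.1 = 0} = ∅ := by
    ext p
    simp only [Set.mem_ofPred_eq, Set.mem_empty_iff_false, iff_false]
    rintro ⟨⟨h1, -⟩, h2⟩
    have := smallest_pos h1.1.1 h1.1.2
    omega
  have hk : ∀ k ∈ Finset.range n,
      genSeries {p | p ∈ {p | p ∈ blackRedPairs ∧ blackRedLevel p = n + 1} ∧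
        smallest p.1 = k + 1} pairSum = X ^ k * (X ^ (n + 1) * seriesGE 1 * seriesGE n) := by
    intro k hk
    obtain ⟨i, rfl⟩ := Nat.exists_eq_add_of_lt (Finset.mem_range.1 hk)
    refine (genSeries_blackRedPairs_smallest k i).trans ?_
    ring
  rw [hset, Finset.sum_range_succ', h0, genSeries_empty, add_zero, Finset.sum_congr rfl hk,
    ← Finset.sum_mul] at hlt
  rw [hlt, seriesGE_succ hn]
  -- The geometric sum contributes `1 - X^n`, which turns `seriesGE n` into `seriesGE (n + 1)`.
  linear_combination (X ^ (n + 1) * seriesGE 1 * seriesGE n) * mul_neg_geom_sum (X : ℚ⟦X⟧) n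

/-! ### Triples of black, red and green parts -/

/-- The triples (black, red, green) underlying the types `3.b` and `4.b`. -/
def coloredTriples (r : ℕ) : Set ((Multiset ℕ × Multiset ℕ) × Multiset ℕ) :=
  {t | t.1 ∈ blackRedPairs ∧ t.2 ∈ gordonParts r r 0 ∧ restCard t.2 + r ≤ blackRedLevel t.1}

/-- The total size of a triple. -/
def tripleSum (t : (Multiset ℕ × Multiset ℕ) × Multiset ℕ) : ℕ := pairSum t.1 + t.2.sum

theorem finiteFibers_coloredTriples (r : ℕ) : FiniteFibers (coloredTriples r) tripleSum :=
  (finiteFibers_blackRedPairs.prod (finiteFibers_gordonParts r r 0)).mono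
    fun _ ht => ⟨ht.1, ht.2.1⟩

theorem genSeries_coloredTriples_level (r s : ℕ) :
    genSeries {t | t ∈ coloredTriples r ∧ blackRedLevel t.1 = s} tripleSum =
      genSeries {p | p ∈ blackRedPairs ∧ blackRedLevel p = s} pairSum *
        seriesGordonRest r s := by
  rw [seriesGordonRest, ← genSeries_prod (finiteFibers_blackRedPairs.mono fun p hp => hp.1)
    ((finiteFibers_gordonParts r r 0).mono fun g hg => hg.1)]
  congr 1
  ext ⟨p, g⟩
  simp only [coloredTriples, Set.mem_ofPred_eq, Set.mem_prod]
  constructor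
  · rintro ⟨⟨h1, h2, h3⟩, h4⟩
    exact ⟨⟨h1, h4⟩, h2, h4 ▸ h3⟩
  · rintro ⟨⟨h1, h4⟩, h2, h3⟩
    exact ⟨⟨h1, h2, h4 ▸ h3⟩, h4⟩

theorem genSeries_coloredTriples {r : ℕ} (hr : 2 ≤ r) :
    (1 - X) * genSeries (coloredTriples r) tripleSum =
      seriesGE 1 * (seriesGE 1 - seriesGordon r r 0) := by
  rw [← sub_eq_zero]
  refine eq_zero_of_X_pow_dvd fun N => ?_
  have h1 := X_pow_dvd_genSeries_sub_sum (finiteFibers_coloredTriples r)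
    (fun t => blackRedLevel t.1)
    (fun t ht => (blackRedLevel_le ht.1).trans (Nat.le_add_right _ _)) N
  have h2 := X_pow_dvd_sum_seriesGordonRest (r := r) (by omega) N
  have h3 : (1 - X) * ∑ s ∈ Finset.range N,
      genSeries {t | t ∈ coloredTriples r ∧ blackRedLevel t.1 = s} tripleSum =
      seriesGE 1 * ∑ s ∈ Finset.range N, X ^ s * (seriesGE s * seriesGordonRest r s) := by
    rw [Finset.mul_sum, Finset.mul_sum]
    refine Finset.sum_congr rfl fun s _ => ?_
    rw [genSeries_coloredTriples_level]
    -- The level formula needs `s ≥ 2`. For smaller `s`, `2 ≤ r` leaves no admissible Gordon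
    -- partition.
    rcases lt_or_ge s 2 with hs | hs
    · have : {g | g ∈ gordonParts r r 0 ∧ restCard g + r ≤ s} = ∅ := by
        ext g
        simp only [Set.mem_ofPred_eq, Set.mem_empty_iff_false, iff_false]
        rintro ⟨-, h⟩
        omega
      rw [seriesGordonRest, this, genSeries_empty]
      simp
    · obtain ⟨n, rfl⟩ := Nat.exists_eq_add_of_le' (show 1 ≤ s by omega)
      rw [← mul_assoc, genSeries_blackRedPairs_level (by omega)]
      ring
  convert (h1.mul_left (1 - X)).sub (h2.mul_left (seriesGE 1)) using 1
  linear_combination h3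

/-! ### Gordon's difference condition versus multiplicities -/

theorem lt_getElem_iff_lt_countP {l : List ℕ} (hl : l.Pairwise (· ≥ ·)) (y i : ℕ)
    (hi : i < l.length) : y < l[i] ↔ i < l.countP (y < ·) := by
  induction l generalizing i with
  | nil => simp at hi
  | cons a l ih =>
    rw [List.pairwise_cons] at hl
    by_cases hy : y < a
    · rw [List.countP_cons_of_pos (by simpa using hy)]
      cases i with
      | zero => simpa using hy
      | succ i =>
        rw [List.getElem_cons_succ, ih hl.2 i (by simpa using hi)]
        omega
    · have h0 : l.countP (y < ·) = 0 := by
        rw [List.countP_eq_zero]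
        intro b hb
        have := hl.1 b hb
        simp only [decide_eq_true_eq]
        omega
      rw [List.countP_cons_of_neg (by simpa using hy), h0]
      cases i with
      | zero => simpa using hy
      | succ i =>
        rw [List.getElem_cons_succ, ih hl.2 i (by simpa using hi), h0]
        omega

theorem lt_getElem_sort_iff (s : Multiset ℕ) (y i : ℕ) (hi : i < (s.sort (· ≥ ·)).length) :
    y < (s.sort (· ≥ ·))[i] ↔ i < s.countP (y < ·) := by
  rw [lt_getElem_iff_lt_countP (Multiset.pairwise_sort s (· ≥ ·))]
  conv_rhs => rw [← Multiset.sort_eq s (· ≥ ·), Multiset.coe_countP]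

theorem countP_lt_eq (s : Multiset ℕ) (y : ℕ) : s.countP (y < ·) =
    s.countP (y + 2 < ·) + (s.count (y + 1) + s.count (y + 2)) := by
  induction s using Multiset.induction_on with
  | empty => simp
  | cons a s ih =>
    simp only [Multiset.countP_cons, Multiset.count_cons, ih]
    split_ifs <;> omega

/-- A failure of the difference condition means that `r` successive parts lie in two consecutive
sizes. Counting the parts above a threshold translates between positions and multiplicities. -/
theorem isGordon_iff {r : ℕ} (hr : 1 ≤ r) {s : Multiset ℕ} (hs : s ∈ partsGE 1) :
    IsGordon r r s ↔ s ∈ gordonParts r r 0 := by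
  have h0 : s.count 0 = 0 := Multiset.count_eq_zero_of_notMem fun h => absurd (hs 0 h) (by omega)
  constructor
  · rintro ⟨h1, h2⟩
    refine ⟨hs, fun x => ?_, by rw [zero_add]; omega⟩
    cases x with
    | zero => rw [h0, zero_add, zero_add]; omega
    | succ y =>
      by_contra! hc
      have hcount := countP_lt_eq s y
      have hlen : s.countP (y < ·) ≤ (s.sort (· ≥ ·)).length := by
        rw [Multiset.length_sort]
        exact Multiset.countP_le_card _ _
      have hc : r ≤ s.count (y + 1) + s.count (y + 2) := hc
      -- This position holds the first part of size at most `y + 2`. The part `r - 1` places later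
      -- still exceeds `y`, so the two differ by at most `1`.
      have hlt : s.countP (y + 2 < ·) + (r - 1) < (s.sort (· ≥ ·)).length := by omega
      have h3 := h1 _ hlt
      have h4 := (lt_getElem_sort_iff s y _ hlt).2 (by omega)
      have h5 := (lt_getElem_sort_iff s (y + 2) (s.countP (y + 2 < ·)) (by omega)).not.2
        (lt_irrefl _)
      omega
  · rintro ⟨-, h1, h2⟩
    refine ⟨fun j hj => ?_, by rw [zero_add] at h2; omega⟩
    by_contra! hc
    have hpos : 1 ≤ (s.sort (· ≥ ·))[j + (r - 1)] :=
      hs _ ((Multiset.mem_sort _).1 (List.getElem_mem hj))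
    -- With `y + 1` the later part, the parts from position `j` to `j + (r - 1)` all have size `y +
    -- 1` or `y + 2`.
    obtain ⟨y, hy⟩ := Nat.exists_eq_add_of_le' hpos
    rw [hy] at hc
    have hcount := countP_lt_eq s y
    have h3 := (lt_getElem_sort_iff s y _ hj).1 (by omega)
    have h4 := (lt_getElem_sort_iff s (y + 2) j (by omega)).not.1 (by omega)
    have := h1 (y + 1)
    rw [show y + 1 + 1 = y + 2 from rfl] at this
    omega

theorem seriesG_eq {r : ℕ} (hr : 1 ≤ r) : seriesG r = seriesGordon r r 0 := by
  ext n
  rw [seriesG, coeff_mk, seriesGordon, coeff_genSeries, ← Nat.card_coe_set_eq,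
    ← Nat.card_coe_set_eq]
  congr 1
  exact Nat.card_congr
    { toFun := fun p => ⟨p.1.parts, (isGordon_iff hr fun _ hx => p.1.parts_pos hx).1 p.2,
        p.1.parts_sum⟩
      invFun := fun s => ⟨⟨s.1, fun {x} hx => s.2.1.1 x hx, s.2.2⟩,
        (isGordon_iff hr s.2.1.1).2 s.2.1⟩
      left_inv := fun _ => rfl
      right_inv := fun _ => rfl }

/-! ### From colored partitions to triples -/

theorem restCard_add_count (s : Multiset ℕ) : restCard s + s.count 1 = s.card := by
  conv_rhs => rw [← replicate_add_filter s 1]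
  rw [Multiset.card_add, Multiset.card_replicate, restCard, add_comm]

/-- The black, red and green subpartitions. -/
def ColoredPartition.toTriple {n : ℕ} (p : ColoredPartition n) :
    (Multiset ℕ × Multiset ℕ) × Multiset ℕ :=
  ((p.sub .black, p.sub .red), p.sub .green)

/-- The multiset of colored parts with given black, red and green parts. -/
def colorParts (t : (Multiset ℕ × Multiset ℕ) × Multiset ℕ) : Multiset (Color × ℕ) :=
  t.1.1.map (Prod.mk Color.black) + t.1.2.map (Prod.mk Color.red) +
    t.2.map (Prod.mk Color.green)

theorem colorParts_toTriple {n : ℕ} (p : ColoredPartition n) :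
    colorParts p.toTriple = p.parts := by
  have key : ∀ m : Multiset (Color × ℕ),
      colorParts (((m.filter fun a => a.1 = .black).map Prod.snd,
        (m.filter fun a => a.1 = .red).map Prod.snd),
        (m.filter fun a => a.1 = .green).map Prod.snd) = m := by
    intro m
    induction m using Multiset.induction_on with
    | empty => simp [colorParts]
    | cons a m ih =>
      obtain ⟨c, x⟩ := a
      conv_rhs => rw [← ih]
      cases c <;> simp [colorParts]
  exact key p.parts

theorem sum_colorParts (t : (Multiset ℕ × Multiset ℕ) × Multiset ℕ) :
    ((colorParts t).map Prod.snd).sum = tripleSum t := by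
  simp [colorParts, tripleSum, pairSum]

theorem sub_pos {n : ℕ} (p : ColoredPartition n) (c : Color) : p.sub c ∈ partsGE 1 := by
  intro x hx
  obtain ⟨a, ha, rfl⟩ := Multiset.mem_map.1 hx
  exact p.parts_pos a (Multiset.mem_filter.1 ha).1

/-- Splitting by color is injective, and every triple of positive parts arises by coloring its three
components. -/
theorem coeff_genSeries_tripleSum {A : Set ((Multiset ℕ × Multiset ℕ) × Multiset ℕ)}
    (hA : A ⊆ (partsGE 1 ×ˢ partsGE 1) ×ˢ partsGE 1) (n : ℕ) :
    coeff n (genSeries A tripleSum) =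
      ({p : ColoredPartition n | p.toTriple ∈ A}.ncard : ℚ) := by
  have hinj : Function.Injective (ColoredPartition.toTriple (n := n)) := by
    intro p q h
    ext1
    rw [← colorParts_toTriple p, h, colorParts_toTriple]
  rw [coeff_genSeries, ← Set.ncard_image_of_injective _ hinj]
  congr 2
  ext t
  constructor
  · rintro ⟨ht, hn⟩
    have hpos : ∀ a ∈ colorParts t, 0 < a.2 := by
      intro a ha
      simp only [colorParts, Multiset.mem_add, Multiset.mem_map] at ha
      rcases ha with (⟨x, hx, rfl⟩ | ⟨x, hx, rfl⟩) | ⟨x, hx, rfl⟩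
      · exact (hA ht).1.1 x hx
      · exact (hA ht).1.2 x hx
      · exact (hA ht).2 x hx
    have h : ColoredPartition.toTriple ⟨colorParts t, hpos, (sum_colorParts t).trans hn⟩ = t := by
      simp [ColoredPartition.toTriple, ColoredPartition.sub, colorParts, Multiset.filter_map]
    exact ⟨_, by rwa [Set.mem_ofPred_eq, h], h⟩
  · rintro ⟨p, hp, rfl⟩
    refine ⟨hp, ?_⟩
    rw [← sum_colorParts, colorParts_toTriple, p.parts_sum]

theorem coloredTriples_subset (r : ℕ) :
    coloredTriples r ⊆ (partsGE 1 ×ˢ partsGE 1) ×ˢ partsGE 1 :=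
  fun _ ht => ⟨⟨ht.1.1.1, ht.1.2.1⟩, gordonParts_subset _ _ _ ht.2.1⟩

theorem isType3b_iff {r n : ℕ} (hr : 1 ≤ r) (p : ColoredPartition n) :
    IsType3b r p ↔ p.toTriple ∈ coloredTriples r ∧ p.toTriple.2 = 0 := by
  have hb := sub_pos p .black
  have hd := sub_pos p .red
  constructor
  · rintro ⟨h1, -, h3, h4, h5⟩
    refine ⟨⟨⟨⟨hb, h1⟩, hd, h4⟩, ?_, ?_⟩, h3⟩
    · simp only [ColoredPartition.toTriple, h3]
      exact ⟨by simp, by simpa using Nat.succ_le_iff.1 hr, by simpa using Nat.succ_le_iff.1 hr⟩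
    · simpa [ColoredPartition.toTriple, h3, restCard, blackRedLevel] using h5
  · rintro ⟨⟨⟨⟨-, h1⟩, -, h4⟩, -, h5⟩, h3⟩
    have hs := smallest_pos hb h1
    simp only [ColoredPartition.toTriple, blackRedLevel] at h1 h3 h4 h5
    refine ⟨h1, fun h0 => ?_, h3, h4, ?_⟩
    · rw [h0, Multiset.card_zero] at h4
      omega
    · omega

/-- The integer inequality says `restCard green + r ≤ k + i_k`, which already implies `r ≤ k + i_k`.
Red parts exist because there are at least `k ≥ 1` of them. -/
theorem isType4b_iff {r n : ℕ} (hr : 1 ≤ r) (p : ColoredPartition n) :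
    IsType4b r p ↔ p.toTriple ∈ coloredTriples r ∧ p.toTriple.2 ≠ 0 := by
  have hb := sub_pos p .black
  have hd := sub_pos p .red
  have hg := isGordon_iff hr (sub_pos p .green)
  have hc := restCard_add_count (p.sub .green)
  constructor
  · rintro ⟨h1, -, h3, h6, h4, h5, h7⟩
    refine ⟨⟨⟨⟨hb, h1⟩, hd, h4⟩, hg.1 h6, ?_⟩, h3⟩
    simp only [ColoredPartition.toTriple, blackRedLevel]
    omega
  · rintro ⟨⟨⟨⟨-, h1⟩, -, h4⟩, h6, h5⟩, h3⟩
    have hs := smallest_pos hb h1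
    simp only [ColoredPartition.toTriple, blackRedLevel] at h1 h3 h4 h5 h6
    refine ⟨h1, fun h0 => ?_, h3, hg.2 h6, h4, ?_, ?_⟩
    · rw [h0, Multiset.card_zero] at h4
      omega
    · omega
    · omega

theorem genSeries_coloredTriples_eq {r : ℕ} (hr : 1 ≤ r) :
    genSeries (coloredTriples r) tripleSum = seriesS3b r + seriesS4b r := by
  rw [genSeries_split (finiteFibers_coloredTriples r) (fun t => t.2 = 0)]
  congr 1
  · ext n
    rw [coeff_genSeries_tripleSum fun t ht => coloredTriples_subset r ht.1, seriesS3b, coeff_mk]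
    simp only [isType3b_iff hr]
    rfl
  · ext n
    rw [coeff_genSeries_tripleSum fun t ht => coloredTriples_subset r ht.1, seriesS4b, coeff_mk]
    simp only [isType4b_iff hr]
    rfl

end ThreeColored

/-- Here `(1 - X)⁻¹` is the genuine inverse, as `1 - X` has constant coefficient `1`. -/
theorem proposition4p3 (r : ℕ) (hr : 2 ≤ r) :
    ThreeColored.seriesS4b r =
      (ThreeColored.seriesH ^ 2 - ThreeColored.seriesH * ThreeColored.seriesG r) *
        (1 - PowerSeries.X)⁻¹ - ThreeColored.seriesS3b r := by
  have h := ThreeColored.genSeries_coloredTriples hr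
  have hr1 : 1 ≤ r := by omega
  rw [ThreeColored.genSeries_coloredTriples_eq hr1, ← ThreeColored.seriesH_eq,
    ← ThreeColored.seriesG_eq hr1] at h
  rw [eq_sub_iff_add_eq, PowerSeries.eq_mul_inv_iff_mul_eq (by simp)]
  linear_combination h
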